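/- **Theorem 1.** Write $\mathbb R_+=[0,\infty)$ and let $f:\mathbb R_+\to\mathbb C$ be continuous with $f(0)=0$. For a complex $m\times n$ matrix $A$ with singular value decomposition $A=U\Sigma V^*$ put $f_s(A)=Uf(\Sigma)V^*$, where $f(\Sigma)$ is obtained by applying $f$ to the singular values on the diagonal; for a compact operator $A=\sum_n s_n\,\langle\,\cdot\,,v_n\rangle u_n$ (with $s_n\ge 0$ and $(u_n)$, $(v_n)$ orthonormal systems) on a Hilbert space put $f_s(A)=\sum_n f(s_n)\,\langle\,\cdot\,,v_n\rangle u_n$. (As $f(0)=0$, $f_s(A)$ does not depend on the choice of the decomposition.) Put, with values in $[0,\infty]$, $$\|f\|_{\mathrm{Lip}}=\sup_{x\neq y}\frac{|f(x)-f(y)|}{|x-y|},\qquad \|f_s\|_{\mathrm{Lip}}=\sup_{A\ne B}\frac{\|f_s(A)-f_s(B)\|}{\|A-B\|},$$ where either $A,B$ range over the complex $m\times n$ matrices for some fixed $m,n\ge1$ and $\|\cdot\|$ is the Frobenius norm, or $A,B$ range over the Hilbert–Schmidt operators on some fixed separable complex Hilbert space $\mathcal H\neq\{0\}$ of finite or infinite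 dimension and $\|\cdot\|$ is the Hilbert–Schmidt norm. Then, for every choice of $m,n$, respectively of $\mathcal H$: 1. $\|f_s\|_{\mathrm{Lip}}\le\sqrt2\,\|f\|_{\mathrm{Lip}}$ for every such $f$; 2. the constant $\sqrt2$ is best possible: if $C\ge 0$ is such that $\|f_s\|_{\mathrm{Lip}}\le C\,\|f\|_{\mathrm{Lip}}$ for all Lipschitz functions $f:\mathbb R_+\to\mathbb C$ with $f(0)=0$, then $C\ge\sqrt2$; 3. if $f$ is real-valued, then $\|f_s\|_{\mathrm{Lip}}=\|f\|_{\mathrm{Lip}}$. -/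

import Mathlib

open scoped NNReal ENNReal

noncomputable section

namespace SingularValueCalculus

/-- The Lipschitz constant `‖f‖_Lip = sup_{x ≠ y} |f x - f y| / |x - y|` of a function on
`ℝ₊ = [0, ∞)`, as an element of `[0, ∞]`. -/
def lipConst (f : ℝ≥0 → ℂ) : ℝ≥0∞ :=
  ⨆ (x : ℝ≥0) (y : ℝ≥0) (_ : x ≠ y), ‖f x - f y‖ₑ / ‖(x : ℝ) - (y : ℝ)‖ₑ

section MatrixCase

/-- The `m × n` matrix with entries `d 0, d 1, …` on the main diagonal and zeros elsewhere. -/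
def rectDiag (m n : ℕ) (d : ℕ → ℂ) : Matrix (Fin m) (Fin n) ℂ :=
  Matrix.of fun i j => if (i : ℕ) = (j : ℕ) then d i else 0

/-- `A = U Σ V*` is a singular value decomposition, `Σ` being the `m × n` diagonal matrix with
diagonal entries `σ 0, σ 1, … ≥ 0`. -/
def IsMatrixSVD {m n : ℕ} (A : Matrix (Fin m) (Fin n) ℂ) (U : Matrix (Fin m) (Fin m) ℂ)
    (σ : ℕ → ℝ≥0) (V : Matrix (Fin n) (Fin n) ℂ) : Prop :=
  U ∈ Matrix.unitaryGroup (Fin m) ℂ ∧ V ∈ Matrix.unitaryGroup (Fin n) ℂ ∧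
    A = U * rectDiag m n (fun k => ((σ k : ℝ) : ℂ)) * V.conjTranspose

/-- `B = U f(Σ) V*` for some singular value decomposition `A = U Σ V*`. -/
def IsMatrixCalc {m n : ℕ} (f : ℝ≥0 → ℂ) (A B : Matrix (Fin m) (Fin n) ℂ) : Prop :=
  ∃ (U : Matrix (Fin m) (Fin m) ℂ) (σ : ℕ → ℝ≥0) (V : Matrix (Fin n) (Fin n) ℂ),
    IsMatrixSVD A U σ V ∧ B = U * rectDiag m n (fun k => f (σ k)) * V.conjTranspose

open Classical in
/-- The singular value functional calculus `f_s(A) = U f(Σ) V*` for matrices, computed from a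
chosen singular value decomposition of `A` (when `f 0 = 0` the choice is immaterial). -/
def matrixCalc {m n : ℕ} (f : ℝ≥0 → ℂ) (A : Matrix (Fin m) (Fin n) ℂ) :
    Matrix (Fin m) (Fin n) ℂ :=
  if h : ∃ B, IsMatrixCalc f A B then h.choose else 0

open scoped Matrix.Norms.Frobenius in
/-- `‖f_s‖_Lip = sup_{A ≠ B} ‖f_s(A) - f_s(B)‖_F / ‖A - B‖_F` over `m × n` complex matrices,
with the Frobenius norm. -/
def matrixLipConst (m n : ℕ) (f : ℝ≥0 → ℂ) : ℝ≥0∞ :=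
  ⨆ (A : Matrix (Fin m) (Fin n) ℂ) (B : Matrix (Fin m) (Fin n) ℂ) (_ : A ≠ B),
    ‖matrixCalc f A - matrixCalc f B‖ₑ / ‖A - B‖ₑ

end MatrixCase

section OperatorCase

variable {H : Type*} [NormedAddCommGroup H] [InnerProductSpace ℂ H] [CompleteSpace H]

/-- `A = ∑ₙ σₙ uₙ ⊗ vₙ`, that is `A h = ∑ₙ σₙ ⟨h, vₙ⟩ uₙ` for all `h`, with `σₙ ≥ 0` and with
orthonormal systems `(uₙ)`, `(vₙ)`. (In Mathlib the inner product is linear in the second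
variable.) -/
def IsSVD (A : H →L[ℂ] H) {ι : Type} (σ : ι → ℝ≥0) (u v : ι → H) : Prop :=
  Orthonormal ℂ u ∧ Orthonormal ℂ v ∧
    ∀ h : H, HasSum (fun n => (((σ n : ℝ) : ℂ) * inner ℂ (v n) h) • u n) (A h)

/-- `T = ∑ₙ f(σₙ) uₙ ⊗ vₙ` for some singular value decomposition `A = ∑ₙ σₙ uₙ ⊗ vₙ`. -/
def IsCalc (f : ℝ≥0 → ℂ) (A T : H →L[ℂ] H) : Prop :=
  ∃ (ι : Type) (σ : ι → ℝ≥0) (u v : ι → H), IsSVD A σ u v ∧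
    ∀ h : H, HasSum (fun n => (f (σ n) * inner ℂ (v n) h) • u n) (T h)

open Classical in
/-- The singular value functional calculus `f_s(A) = ∑ₙ f(σₙ) uₙ ⊗ vₙ` for (compact) operators,
computed from a chosen singular value decomposition of `A` (when `f 0 = 0` the choice is
immaterial). -/
def opCalc (f : ℝ≥0 → ℂ) (A : H →L[ℂ] H) : H →L[ℂ] H :=
  if h : ∃ T, IsCalc f A T then h.choose else 0

/-- The Hilbert–Schmidt norm `(∑ᵢ ‖T eᵢ‖²)^{1/2} ∈ [0, ∞]`, where `(eᵢ)` is an orthonormal basis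
of `H`; see `hsNorm_eq` for the independence of the basis. -/
def hsNorm (T : H →L[ℂ] H) : ℝ≥0∞ :=
  (∑' i, ‖T ((exists_hilbertBasis ℂ H).choose_spec.choose i)‖ₑ ^ 2) ^ (1 / 2 : ℝ)

theorem tsum_enorm_inner_sq {ι H : Type*} [NormedAddCommGroup H] [InnerProductSpace ℂ H]
    (b : HilbertBasis ι ℂ H) (x : H) :
    ∑' i, ‖(inner ℂ (b i) x : ℂ)‖ₑ ^ 2 = ‖x‖ₑ ^ 2 := by
  have h := b.hasSum_inner_mul_inner x x
  have h2 : HasSum (fun i => ‖(inner ℂ (b i) x : ℂ)‖ ^ 2) (‖x‖ ^ 2) := by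
    have h3 := Complex.hasSum_re h
    convert h3 using 1
    · funext i
      rw [← inner_conj_symm x (b i), ← Complex.normSq_eq_conj_mul_self, Complex.normSq_eq_norm_sq]
      exact (Complex.ofReal_re _).symm
    · exact (inner_self_eq_norm_sq (𝕜 := ℂ) x).symm
  have h4 := ENNReal.ofReal_tsum_of_nonneg (fun i => by positivity) h2.summable
  rw [h2.tsum_eq] at h4
  simpa [ENNReal.ofReal_pow, ofReal_norm] using h4.symm

theorem tsum_enorm_sq_eq_adjoint {ι κ : Type*} (b : HilbertBasis ι ℂ H) (c : HilbertBasis κ ℂ H)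
    (T : H →L[ℂ] H) : ∑' k, ‖T (c k)‖ₑ ^ 2 = ∑' i, ‖T.adjoint (b i)‖ₑ ^ 2 := by
  have h1 : ∀ k, ‖T (c k)‖ₑ ^ 2 = ∑' i, ‖(inner ℂ (b i) (T (c k)) : ℂ)‖ₑ ^ 2 :=
    fun k => (tsum_enorm_inner_sq b _).symm
  have h2 : ∀ i, ‖T.adjoint (b i)‖ₑ ^ 2 = ∑' k, ‖(inner ℂ (c k) (T.adjoint (b i)) : ℂ)‖ₑ ^ 2 :=
    fun i => (tsum_enorm_inner_sq c _).symm
  rw [tsum_congr h1, tsum_congr h2, ENNReal.tsum_comm]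
  refine tsum_congr fun i => tsum_congr fun k => ?_
  rw [ContinuousLinearMap.adjoint_inner_right, ← inner_conj_symm, RCLike.enorm_conj]

/-- The Hilbert–Schmidt norm can be computed in any orthonormal basis. -/
theorem hsNorm_eq {ι : Type*} (b : HilbertBasis ι ℂ H) (T : H →L[ℂ] H) :
    hsNorm T = (∑' i, ‖T (b i)‖ₑ ^ 2) ^ (1 / 2 : ℝ) := by
  rw [hsNorm, tsum_enorm_sq_eq_adjoint b, ← tsum_enorm_sq_eq_adjoint b b]

/-- The Hilbert–Schmidt class `𝒮₂`: compact operators with finite Hilbert–Schmidt norm. -/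
def IsHilbertSchmidt (T : H →L[ℂ] H) : Prop :=
  IsCompactOperator T ∧ hsNorm T < ∞

variable (H) in
/-- `‖f_s‖_Lip = sup_{A ≠ B} ‖f_s(A) - f_s(B)‖_{𝒮₂} / ‖A - B‖_{𝒮₂}`, the supremum being over all
`A`, `B` in the Hilbert–Schmidt class of `H`. -/
def opLipConst (f : ℝ≥0 → ℂ) : ℝ≥0∞ :=
  ⨆ (A : H →L[ℂ] H) (B : H →L[ℂ] H) (_ : IsHilbertSchmidt A) (_ : IsHilbertSchmidt B)
    (_ : A ≠ B), hsNorm (opCalc f A - opCalc f B) / hsNorm (A - B)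

end OperatorCase

end SingularValueCalculus

end

/-!
All assertions, for matrices and for operators, reduce to `1 × 1` matrices, on which
the calculus is the map `z ↦ f |z| · z / |z|` (`radial`).

*Upper bounds.* Let `A = ∑ σᵢ uᵢ ⊗ vᵢ` and `B = ∑ τⱼ xⱼ ⊗ yⱼ`, and put `a = ⟨xⱼ, uᵢ⟩`,
`b = ⟨yⱼ, vᵢ⟩`, where `⟨·, ·⟩` is linear in the second variable. Expanding `A - B` in bases
extending `(vᵢ)` and `(xⱼ)`, and again in bases extending `(yⱼ)` and `(uᵢ)`, expresses
`2 ‖A - B‖²` as the sum over `i, j` of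
`|σᵢ a - τⱼ b|² + |τⱼ ā - σᵢ b̄|² = 2 |a b| |σᵢ - ω τⱼ|² + (|a| - |b|)² (σᵢ² + τⱼ²)`, with the
phase `ω` for which `a b̄ ω = |a b|`, plus multiples of `σᵢ²` and `τⱼ²` from the vectors that complete
the systems to bases. The same identity holds for `f_s(A) - f_s(B)` with `f σᵢ`, `f τⱼ` in place of
`σᵢ`, `τⱼ`, so a scalar inequality `|f s - ω f t|² ≤ K |s - ω t|²` for all `|ω| = 1`
(`ScalarBound`) gives `‖f_s(A) - f_s(B)‖² ≤ K ‖A - B‖²` (`hsSq_sub_le`). All sums are sums of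
nonnegative terms, so no question of convergence arises. The scalar inequality holds with
`K = 2 L²` for every `L`-Lipschitz `f` with `f 0 = 0` (`scalarBound_two_mul`) and with `K = L²` if
`f` is real-valued (`scalarBound_of_real`).

*Lower bounds.* The calculus of the operators `z · e ⊗ e` is the scalar one
(`IsSchmidtSum.eq_radial`), so the Lipschitz constant of `radial f` is a lower bound. On `[0, ∞)` it
gives `‖f‖_Lip`; for the function `corner`, which turns by a right angle at `1`, it gives `√2`
(`sqrt_two_le_of_radial_corner`).

Operators between two different Hilbert spaces are allowed throughout, so that rectangular matrices
are covered by the same lemmas. Singular value decompositions exist by the spectral theorem for the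
compact operator `A* A` (`exists_isSchmidtSum`, `exists_isMatrixSVD`).
-/

open scoped NNReal ENNReal

noncomputable section

namespace SingularValueCalculus

/-! ### Schmidt sums and Hilbert–Schmidt norms -/

section Schmidt

variable {E F : Type*} [NormedAddCommGroup E] [InnerProductSpace ℂ E]
  [NormedAddCommGroup F] [InnerProductSpace ℂ F]

/-- `A = ∑ₙ cₙ uₙ ⊗ vₙ` strongly, with orthonormal systems `(uₙ)`, `(vₙ)` and complex
coefficients `cₙ`, for an operator between two possibly different Hilbert spaces. -/
def IsSchmidtSum {ι : Type*} (c : ι → ℂ) (u : ι → F) (v : ι → E) (A : E →L[ℂ] F) : Prop :=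
  Orthonormal ℂ u ∧ Orthonormal ℂ v ∧ ∀ h, HasSum (fun n => (c n * inner ℂ (v n) h) • u n) (A h)

namespace IsSchmidtSum

variable {ι : Type*} {c : ι → ℂ} {u : ι → F} {v : ι → E} {A : E →L[ℂ] F}

theorem inner_apply (hA : IsSchmidtSum c u v A) (i : ι) (h : E) :
    inner ℂ (u i) (A h) = c i * inner ℂ (v i) h := by
  have h1 := (hA.2.2 h).mapL (innerSL ℂ (u i))
  have h2 := hasSum_single (f := fun n => innerSL ℂ (u i) ((c n * inner ℂ (v n) h) • u n)) i
    (fun n hn => by simp [hA.1.2 hn.symm])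
  rw [← innerSL_apply_apply ℂ, h1.unique h2]
  simp [inner_self_eq_norm_sq_to_K, hA.1.1]

theorem apply_eq_zero (hA : IsSchmidtSum c u v A) {h : E} (hh : ∀ i, inner ℂ (v i) h = 0) :
    A h = 0 :=
  (hA.2.2 h).unique (by simp [hh])

theorem apply_right (hA : IsSchmidtSum c u v A) (i : ι) : A (v i) = c i • u i := by
  refine (hA.2.2 (v i)).unique ?_
  convert hasSum_single (f := fun n => (c n * inner ℂ (v n) (v i)) • u n) i
    (fun n hn => by simp [hA.2.1.2 hn]) using 1
  simp [inner_self_eq_norm_sq_to_K, hA.2.1.1]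

theorem inner_eq_zero (hA : IsSchmidtSum c u v A) {y : F} (hy : ∀ i, inner ℂ y (u i) = 0)
    (h : E) : inner ℂ y (A h) = 0 := by
  have h1 := (hA.2.2 h).mapL (innerSL ℂ y)
  refine h1.unique ?_
  simp [hy]

end IsSchmidtSum

/-- An orthonormal family extends to a Hilbert basis whose index type is the old one plus a
complementary part. -/
theorem _root_.Orthonormal.exists_hilbertBasis_sum [CompleteSpace E] {ι : Type*} {v : ι → E}
    (hv : Orthonormal ℂ v) :
    ∃ (κ : Set E) (b : HilbertBasis (ι ⊕ κ) ℂ E), ∀ i, b (Sum.inl i) = v i := by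
  obtain ⟨w, b, hw, hb⟩ := (hv.toSubtypeRange).exists_hilbertBasis_extension
  have hbo : Orthonormal ℂ ((↑) : w → E) := hb ▸ b.orthonormal
  have hvi := hv.linearIndependent.injective
  let g : ι ⊕ ↥(w \ Set.range v) → w :=
    Sum.elim (fun i => ⟨v i, hw ⟨i, rfl⟩⟩) (fun k => ⟨k, k.2.1⟩)
  have hg : Function.Injective g := by
    rintro (i | k) (j | l) h
    · exact congrArg _ (hvi (congrArg Subtype.val h))
    · exact absurd ⟨i, congrArg Subtype.val h⟩ l.2.2
    · exact absurd ⟨j, (congrArg Subtype.val h).symm⟩ k.2.2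
    · exact congrArg _ (Subtype.ext (congrArg Subtype.val h :))
  have hg' : Function.Surjective g := by
    rintro ⟨x, hx⟩
    by_cases h : x ∈ Set.range v
    · obtain ⟨i, rfl⟩ := h
      exact ⟨Sum.inl i, rfl⟩
    · exact ⟨Sum.inr ⟨x, hx, h⟩, rfl⟩
  refine ⟨w \ Set.range v, HilbertBasis.mk (v := fun i => (g i : E)) (hbo.comp g hg) ?_, ?_⟩
  · have h1 : Set.range (fun i => (g i : E)) = Set.range b := by
      rw [hb]
      exact hg'.range_comp (fun x : w => (x : E))
    rw [h1, b.dense_span]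
  · intro i
    simp [g]

variable [CompleteSpace E]

/-- The square of the Hilbert–Schmidt norm of an operator between two Hilbert spaces, computed in a
chosen Hilbert basis; see `hsSq_eq` for the independence of the basis. -/
def hsSq (A : E →L[ℂ] F) : ℝ≥0∞ :=
  ∑' i, ‖A ((exists_hilbertBasis ℂ E).choose_spec.choose i)‖ₑ ^ 2

theorem hsSq_sub_comm (A B : E →L[ℂ] F) : hsSq (A - B) = hsSq (B - A) := by
  unfold hsSq
  refine tsum_congr fun i => ?_
  rw [← neg_sub, neg_apply, enorm_neg]

variable [CompleteSpace F]

theorem tsum_enorm_apply_sq {ι κ : Type*} (b : HilbertBasis ι ℂ E) (c : HilbertBasis κ ℂ F)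
    (A : E →L[ℂ] F) :
    ∑' i, ‖A (b i)‖ₑ ^ 2 = ∑' j, ‖A.adjoint (c j)‖ₑ ^ 2 := by
  simp_rw [← tsum_enorm_inner_sq c (A _), ← tsum_enorm_inner_sq b (A.adjoint _)]
  rw [ENNReal.tsum_comm]
  refine tsum_congr fun j => tsum_congr fun i => ?_
  rw [ContinuousLinearMap.adjoint_inner_right, ← inner_conj_symm, RCLike.enorm_conj]

theorem hsSq_eq {ι : Type*} (b : HilbertBasis ι ℂ E) (A : E →L[ℂ] F) :
    hsSq A = ∑' i, ‖A (b i)‖ₑ ^ 2 := by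
  obtain ⟨w, c, -⟩ := exists_hilbertBasis ℂ F
  rw [hsSq, tsum_enorm_apply_sq _ c, tsum_enorm_apply_sq _ c]

theorem hsSq_eq_tsum_inner {ι κ : Type*} (b : HilbertBasis ι ℂ E) (c : HilbertBasis κ ℂ F)
    (A : E →L[ℂ] F) : hsSq A = ∑' i, ∑' j, ‖inner ℂ (c j) (A (b i))‖ₑ ^ 2 := by
  simp_rw [hsSq_eq b, tsum_enorm_inner_sq]

/-- The norm `‖A - B‖²` is computed in Hilbert bases that extend `v` and `x`. All matrix entries of
`A - B` with both indices in the added parts vanish; those with one index there contribute the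
weighted sums, whose weights `w`, `z` depend only on the orthonormal systems and hence are shared
by all pairs `A`, `B` with these systems. -/
theorem exists_hsSq_sub_eq {ι κ : Type*} {u : ι → F} {v : ι → E} {x : κ → F} {y : κ → E}
    (hv : Orthonormal ℂ v) (hx : Orthonormal ℂ x) :
    ∃ (w : ι → ℝ≥0∞) (z : κ → ℝ≥0∞), ∀ (c : ι → ℂ) (d : κ → ℂ) (A B : E →L[ℂ] F),
      IsSchmidtSum c u v A → IsSchmidtSum d x y B →
      hsSq (A - B) =
        ∑' i, ∑' j, ‖c i * inner ℂ (x j) (u i) - d j * inner ℂ (y j) (v i)‖ₑ ^ 2 +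
          ∑' i, ‖c i‖ₑ ^ 2 * w i + ∑' j, ‖d j‖ₑ ^ 2 * z j := by
  obtain ⟨κv, bv, hbv⟩ := hv.exists_hilbertBasis_sum
  obtain ⟨κx, bx, hbx⟩ := hx.exists_hilbertBasis_sum
  refine ⟨fun i => ∑' k, ‖inner ℂ (bx (Sum.inr k)) (u i)‖ₑ ^ 2,
    fun j => ∑' k, ‖inner ℂ (y j) (bv (Sum.inr k))‖ₑ ^ 2, fun c d A B hA hB => ?_⟩
  have hA0 : ∀ k, A (bv (Sum.inr k)) = 0 := fun k => hA.apply_eq_zero fun i => by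
    rw [← hbv]; exact bv.orthonormal.2 (by simp)
  have hB0 : ∀ k h, inner ℂ (bx (Sum.inr k)) (B h) = 0 := fun k => hB.inner_eq_zero fun i => by
    rw [← hbx]; exact bx.orthonormal.2 (by simp)
  rw [hsSq_eq_tsum_inner bv bx]
  simp_rw [Summable.tsum_sum (ENNReal.summable) ENNReal.summable]
  simp only [hbv, hbx, sub_apply, inner_sub_right, hA0, hB0, hA.apply_right,
    hB.inner_apply, inner_neg_right, zero_sub, sub_zero, inner_smul_right, enorm_neg, enorm_mul,
    mul_pow, enorm_zero, ENNReal.tsum_mul_left]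
  rw [ENNReal.tsum_add]
  congr 1
  simp_rw [← ENNReal.tsum_mul_left]
  rw [ENNReal.tsum_comm]
  simp

end Schmidt

/-! ### From scalars to operators -/

/-- The bound of the functional calculus on `1 × 1` matrices, up to a common phase of the two
matrices: for `|ω| = 1`, the numbers `s` and `ω t` have the calculus values `f s` and `ω f t`. -/
def ScalarBound (f : ℝ≥0 → ℂ) (K : ℝ) : Prop :=
  ∀ (s t : ℝ≥0) (ω : ℂ), ‖ω‖ = 1 →
    ‖f s - ω * f t‖ ^ 2 ≤ K * ‖((s : ℝ) : ℂ) - ω * ((t : ℝ) : ℂ)‖ ^ 2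

/-- The sum of the squared moduli of an entry of `A - B` and of the matching entry with the roles of
the two pairs of orthonormal systems exchanged. It sees the singular values only through
`|c - ω d|` and `|c|² + |d|²`, where the phase `ω` depends on the orthonormal systems alone. -/
theorem norm_sub_sq_add_norm_sub_conj_sq (c d a b ω : ℂ) (hω : ‖ω‖ = 1)
    (hab : a * (starRingEnd ℂ) b * ω = ‖a‖ * ‖b‖) :
    ‖c * a - d * b‖ ^ 2 + ‖d * (starRingEnd ℂ) a - c * (starRingEnd ℂ) b‖ ^ 2 =
      2 * ‖a‖ * ‖b‖ * ‖c - ω * d‖ ^ 2 + (‖a‖ - ‖b‖) ^ 2 * (‖c‖ ^ 2 + ‖d‖ ^ 2) := by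
  have h1 : a * (starRingEnd ℂ) b = ‖a‖ * ‖b‖ * (starRingEnd ℂ) ω := by
    rw [← hab, mul_assoc _ ω, Complex.mul_conj, Complex.normSq_eq_norm_sq, hω]; simp
  have e : ∀ p q : ℂ, ‖p - q‖ ^ 2 = ‖p‖ ^ 2 + ‖q‖ ^ 2 - 2 * (p * (starRingEnd ℂ) q).re := by
    intro p q
    rw [← Complex.normSq_eq_norm_sq, ← Complex.normSq_eq_norm_sq, ← Complex.normSq_eq_norm_sq,
      Complex.normSq_sub]
  rw [e, e, e]
  have h2 : c * a * (starRingEnd ℂ) (d * b) =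
      ((‖a‖ * ‖b‖ : ℝ) : ℂ) * (c * (starRingEnd ℂ) (ω * d)) := by
    push_cast
    rw [map_mul, map_mul]
    linear_combination c * (starRingEnd ℂ) d * h1
  have h3 : d * (starRingEnd ℂ) a * (starRingEnd ℂ) (c * (starRingEnd ℂ) b) =
      ((‖a‖ * ‖b‖ : ℝ) : ℂ) * (starRingEnd ℂ) (c * (starRingEnd ℂ) (ω * d)) := by
    have h4 := congrArg (starRingEnd ℂ) h1
    simp only [map_mul, Complex.conj_conj, Complex.conj_ofReal] at h4 ⊢
    push_cast
    linear_combination d * (starRingEnd ℂ) c * h4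
  rw [h2, h3, Complex.re_ofReal_mul, Complex.re_ofReal_mul, Complex.conj_re]
  simp only [norm_mul, RCLike.norm_conj, hω]
  ring

theorem exists_phase (p : ℂ) : ∃ ω : ℂ, ‖ω‖ = 1 ∧ p * ω = ‖p‖ := by
  by_cases hp : p = 0
  · exact ⟨1, by simp [hp]⟩
  · have hp' : (‖p‖ : ℂ) ≠ 0 := by simpa using hp
    refine ⟨‖p‖ / p, by simp [hp], by field_simp⟩

theorem ScalarBound.norm_sq_le {f : ℝ≥0 → ℂ} {K : ℝ} (hf : ScalarBound f K) (h0 : f 0 = 0)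
    (s : ℝ≥0) : ‖f s‖ ^ 2 ≤ K * ‖((s : ℝ) : ℂ)‖ ^ 2 := by
  simpa [h0] using hf s 0 1 (by simp)

theorem ScalarBound.add_le {f : ℝ≥0 → ℂ} {K : ℝ} (hf : ScalarBound f K) (h0 : f 0 = 0)
    (s t : ℝ≥0) (a b : ℂ) :
    ‖f s * a - f t * b‖ ^ 2 + ‖f t * (starRingEnd ℂ) a - f s * (starRingEnd ℂ) b‖ ^ 2 ≤
      K * (‖((s : ℝ) : ℂ) * a - ((t : ℝ) : ℂ) * b‖ ^ 2 +
        ‖((t : ℝ) : ℂ) * (starRingEnd ℂ) a - ((s : ℝ) : ℂ) * (starRingEnd ℂ) b‖ ^ 2) := by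
  obtain ⟨ω, hω, hab⟩ := exists_phase (a * (starRingEnd ℂ) b)
  rw [norm_mul, RCLike.norm_conj, Complex.ofReal_mul] at hab
  rw [norm_sub_sq_add_norm_sub_conj_sq _ _ _ _ ω hω hab,
    norm_sub_sq_add_norm_sub_conj_sq _ _ _ _ ω hω hab]
  have h1 := mul_le_mul_of_nonneg_left (hf s t ω hω) (by positivity : 0 ≤ 2 * ‖a‖ * ‖b‖)
  have h2 := mul_le_mul_of_nonneg_left (add_le_add (hf.norm_sq_le h0 s) (hf.norm_sq_le h0 t))
    (sq_nonneg (‖a‖ - ‖b‖))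
  linarith

theorem enorm_sq_eq_ofReal {G : Type*} [SeminormedAddGroup G] (x : G) :
    ‖x‖ₑ ^ 2 = ENNReal.ofReal (‖x‖ ^ 2) := by
  rw [ENNReal.ofReal_pow (norm_nonneg _), ofReal_norm]

theorem ScalarBound.tsum_mul_le {f : ℝ≥0 → ℂ} {K : ℝ} (hK : 0 ≤ K) (hf : ScalarBound f K)
    (h0 : f 0 = 0) {ι : Type*} (σ : ι → ℝ≥0) (w : ι → ℝ≥0∞) :
    ∑' i, ‖f (σ i)‖ₑ ^ 2 * w i ≤
      ENNReal.ofReal K * ∑' i, ‖((σ i : ℝ) : ℂ)‖ₑ ^ 2 * w i := by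
  rw [← ENNReal.tsum_mul_left]
  refine ENNReal.tsum_le_tsum fun i => ?_
  rw [← mul_assoc, enorm_sq_eq_ofReal, enorm_sq_eq_ofReal, ← ENNReal.ofReal_mul hK]
  exact mul_le_mul_left (ENNReal.ofReal_le_ofReal (hf.norm_sq_le h0 _)) _

/-- A bound for the calculus on `1 × 1` matrices passes to all operators with a Schmidt
decomposition. The norm is expanded twice, over bases extending `(v, x)` and over bases extending
`(y, u)`, because only the sum of the two expansions can be compared term by term. -/
theorem hsSq_sub_le {E F : Type*} [NormedAddCommGroup E] [InnerProductSpace ℂ E]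
    [NormedAddCommGroup F] [InnerProductSpace ℂ F] [CompleteSpace E] [CompleteSpace F]
    {f : ℝ≥0 → ℂ} {K : ℝ} (hK : 0 ≤ K) (hf : ScalarBound f K) (h0 : f 0 = 0)
    {ι κ : Type*} {σ : ι → ℝ≥0} {τ : κ → ℝ≥0}
    {u : ι → F} {v : ι → E} {x : κ → F} {y : κ → E} {A B S T : E →L[ℂ] F}
    (hA : IsSchmidtSum (fun n => ((σ n : ℝ) : ℂ)) u v A)
    (hS : IsSchmidtSum (fun n => f (σ n)) u v S)
    (hB : IsSchmidtSum (fun n => ((τ n : ℝ) : ℂ)) x y B)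
    (hT : IsSchmidtSum (fun n => f (τ n)) x y T) :
    hsSq (S - T) ≤ ENNReal.ofReal K * hsSq (A - B) := by
  obtain ⟨w, z, h1⟩ := exists_hsSq_sub_eq (u := u) (y := y) hA.2.1 hB.1
  obtain ⟨w', z', h2⟩ := exists_hsSq_sub_eq (u := x) (y := v) hB.2.1 hA.1
  have e1 := h1 _ _ _ _ hA hB
  have e2 := h2 _ _ _ _ hB hA
  have e3 := h1 _ _ _ _ hS hT
  have e4 := h2 _ _ _ _ hT hS
  rw [hsSq_sub_comm, ENNReal.tsum_comm] at e2 e4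
  have hd : ∑' i, ∑' j, ‖f (σ i) * inner ℂ (x j) (u i) - f (τ j) * inner ℂ (y j) (v i)‖ₑ ^ 2 +
      ∑' i, ∑' j, ‖f (τ j) * inner ℂ (u i) (x j) - f (σ i) * inner ℂ (v i) (y j)‖ₑ ^ 2 ≤
      ENNReal.ofReal K * (∑' i, ∑' j, ‖((σ i : ℝ) : ℂ) * inner ℂ (x j) (u i) -
          ((τ j : ℝ) : ℂ) * inner ℂ (y j) (v i)‖ₑ ^ 2 +
        ∑' i, ∑' j, ‖((τ j : ℝ) : ℂ) * inner ℂ (u i) (x j) -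
          ((σ i : ℝ) : ℂ) * inner ℂ (v i) (y j)‖ₑ ^ 2) := by
    rw [← ENNReal.tsum_add, ← ENNReal.tsum_add, ← ENNReal.tsum_mul_left]
    refine ENNReal.tsum_le_tsum fun i => ?_
    rw [← ENNReal.tsum_add, ← ENNReal.tsum_add, ← ENNReal.tsum_mul_left]
    refine ENNReal.tsum_le_tsum fun j => ?_
    simp only [enorm_sq_eq_ofReal]
    rw [← ENNReal.ofReal_add (by positivity) (by positivity),
      ← ENNReal.ofReal_add (by positivity) (by positivity), ← ENNReal.ofReal_mul hK]
    refine ENNReal.ofReal_le_ofReal ?_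
    rw [← inner_conj_symm (u i) (x j), ← inner_conj_symm (v i) (y j)]
    exact hf.add_le h0 _ _ _ _
  have key : hsSq (S - T) + hsSq (S - T) ≤ ENNReal.ofReal K * (hsSq (A - B) + hsSq (A - B)) := by
    nth_rewrite 1 [e3]
    rw [e4]
    nth_rewrite 1 [e1]
    rw [e2]
    calc _ = (∑' i, ∑' j, ‖f (σ i) * inner ℂ (x j) (u i) - f (τ j) * inner ℂ (y j) (v i)‖ₑ ^ 2 +
          ∑' i, ∑' j, ‖f (τ j) * inner ℂ (u i) (x j) - f (σ i) * inner ℂ (v i) (y j)‖ₑ ^ 2) +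
          ((∑' i, ‖f (σ i)‖ₑ ^ 2 * w i + ∑' j, ‖f (τ j)‖ₑ ^ 2 * z j) +
          (∑' j, ‖f (τ j)‖ₑ ^ 2 * w' j + ∑' i, ‖f (σ i)‖ₑ ^ 2 * z' i)) := by abel
      _ ≤ _ := add_le_add hd (add_le_add
          (add_le_add (hf.tsum_mul_le hK h0 σ w) (hf.tsum_mul_le hK h0 τ z))
          (add_le_add (hf.tsum_mul_le hK h0 τ w') (hf.tsum_mul_le hK h0 σ z')))
      _ = _ := by
        simp only [mul_add]
        abel
  rw [← two_mul, ← two_mul, mul_left_comm] at key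
  exact (ENNReal.mul_le_mul_iff_right two_ne_zero ENNReal.ofNat_ne_top).1 key

/-! ### Existence of singular value decompositions -/

section Existence

variable {E F : Type*} [NormedAddCommGroup E] [InnerProductSpace ℂ E]
  [NormedAddCommGroup F] [InnerProductSpace ℂ F]

theorem _root_.Orthonormal.countable [TopologicalSpace.SeparableSpace E] {ι : Type*} {v : ι → E}
    (hv : Orthonormal ℂ v) : Countable ι := by
  refine Pairwise.countable_of_isOpen_disjoint (s := fun i => Metric.ball (v i) (1 / 2)) ?_
    (fun i => Metric.isOpen_ball) (fun i => ⟨v i, by simp⟩)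
  intro i j hij
  refine Metric.ball_disjoint_ball ?_
  have h1 : ‖v i - v j‖ ^ 2 = 2 := by
    rw [@norm_sub_sq ℂ, hv.1, hv.1, hv.2 hij]
    norm_num
  rw [dist_eq_norm]
  nlinarith [norm_nonneg (v i - v j)]

/-- A compact self-adjoint operator has a Hilbert basis of eigenvectors: Hilbert bases of all
eigenspaces are joined, and the spectral theorem says that their span is dense. -/
theorem exists_hilbertBasis_eigenvectors.{u} {E : Type u} [NormedAddCommGroup E]
    [InnerProductSpace ℂ E] [CompleteSpace E] {T : E →L[ℂ] E}
    (hT : IsCompactOperator T) (hT' : (T : E →ₗ[ℂ] E).IsSymmetric) :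
    ∃ (ι : Type u) (b : HilbertBasis ι ℂ E) (μ : ι → ℂ), ∀ i, T (b i) = μ i • b i := by
  let V : ℂ → Submodule ℂ E := fun μ => Module.End.eigenspace (T : Module.End ℂ E) μ
  have hV : ∀ μ x, x ∈ V μ ↔ T x = μ • x := fun μ x => Module.End.mem_eigenspace_iff
  have hc : ∀ μ, IsClosed (V μ : Set E) := fun μ => by
    have : (V μ : Set E) = {x | T x = μ • x} := Set.ext fun x => hV μ x
    rw [this]
    exact isClosed_eq T.continuous (continuous_const_smul μ)
  have : ∀ μ, CompleteSpace (V μ) := fun μ => (hc μ).completeSpace_coe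
  choose w b hb using fun μ => exists_hilbertBasis ℂ (V μ)
  have ho := hT'.orthogonalFamily_eigenspaces.orthonormal_sigma_orthonormal
    (fun μ => (b μ).orthonormal)
  refine ⟨_, HilbertBasis.mkOfOrthogonalEqBot ho ?_, fun a => a.1, fun a => ?_⟩
  · rw [eq_bot_iff, ← ContinuousLinearMap.orthogonalComplement_iSup_eigenspaces_eq_bot hT hT']
    intro x hx
    rw [Submodule.mem_orthogonal'] at hx
    have hx' : ∀ μ (y : V μ), inner ℂ x (y : E) = 0 := by
      intro μ y
      have h1 := ((b μ).hasSum_repr y).mapL ((innerSL ℂ x).comp (V μ).subtypeL)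
      refine h1.unique ?_
      have h2 : ∀ k, inner ℂ x (b μ k : E) = 0 := fun k =>
        hx _ (Submodule.subset_span ⟨⟨μ, k⟩, rfl⟩)
      simp [h2]
    rw [← Submodule.iInf_orthogonal, Submodule.mem_iInf]
    intro μ
    rw [Submodule.mem_orthogonal']
    exact fun y hy => hx' μ ⟨y, hy⟩
  · rw [HilbertBasis.coe_mkOfOrthogonalEqBot]
    exact (hV _ _).1 (b a.1 a.2).2

/-- A compact operator `A` has a singular value decomposition: the `vₙ` are the eigenvectors of
`A* A` outside the kernel of `A`. Separability allows the index type to be taken in `Type`. -/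
theorem exists_isSchmidtSum [CompleteSpace E] [CompleteSpace F]
    [TopologicalSpace.SeparableSpace E] {A : E →L[ℂ] F} (hA : IsCompactOperator A) :
    ∃ (ι : Type) (σ : ι → ℝ≥0) (u : ι → F) (v : ι → E),
      IsSchmidtSum (fun n => ((σ n : ℝ) : ℂ)) u v A := by
  obtain ⟨κ, b, μ, hb⟩ := exists_hilbertBasis_eigenvectors (T := A.adjoint ∘L A)
    (hA.clm_comp A.adjoint) (ContinuousLinearMap.isPositive_adjoint_comp_self A).isSymmetric
  have horth : ∀ i j, i ≠ j → inner ℂ (A (b i)) (A (b j)) = 0 := fun i j hij => by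
    rw [← ContinuousLinearMap.adjoint_inner_right]
    have := hb j
    rw [ContinuousLinearMap.comp_apply] at this
    rw [this, inner_smul_right, b.orthonormal.2 hij, mul_zero]
  let J : Set κ := {i | A (b i) ≠ 0}
  have : Countable κ := b.orthonormal.countable
  -- Reindexing by a set of natural numbers puts the index type into `Type`.
  obtain ⟨g, hg⟩ := exists_injective_nat J
  let e : Set.range g ≃ J := (Equiv.ofInjective g hg).symm
  have hn : ∀ i : J, ((‖A (b i)‖ : ℝ) : ℂ) ≠ 0 := fun i =>
    Complex.ofReal_ne_zero.2 (norm_ne_zero_iff.2 i.2)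
  have hu : Orthonormal ℂ (fun i : J => ((‖A (b i)‖ : ℂ)⁻¹) • A (b i)) := by
    refine ⟨fun i => ?_, fun i j hij => ?_⟩
    · rw [norm_smul, norm_inv, Complex.norm_real, norm_norm, inv_mul_cancel₀]
      exact norm_ne_zero_iff.2 i.2
    · beta_reduce
      rw [inner_smul_left, inner_smul_right, horth _ _ (fun h => hij (Subtype.ext h))]
      simp
  have hv : Orthonormal ℂ (fun i : J => b i) := b.orthonormal.comp _ Subtype.coe_injective
  refine ⟨Set.range g, fun k => ‖A (b (e k))‖₊, _, _, hu.comp e e.injective,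
    hv.comp e e.injective, fun h => ?_⟩
  have h1 := (b.hasSum_repr h).mapL A
  rw [← hasSum_subtype_iff_of_support_subset (s := J), ← e.hasSum_iff] at h1
  · convert h1 using 2 with k
    have := hn (e k)
    simp only [Function.comp_apply, map_smul, HilbertBasis.repr_apply_apply, smul_smul]
    congr 1
    push_cast
    rw [mul_right_comm, mul_inv_cancel₀ this, one_mul]
  · intro i hi
    simp only [Function.mem_support, map_smul] at hi
    exact fun h0 => hi (by simp [h0])

/-- Bounded coefficients define a bounded operator; its boundedness comes from the Banach–Steinhaus
theorem, as a strong limit of the finite partial sums, which is where countability enters. -/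
theorem exists_isSchmidtSum_of_bounded [CompleteSpace E] [CompleteSpace F] {ι : Type*}
    [Countable ι] {u : ι → F} {v : ι → E} (hu : Orthonormal ℂ u) (hv : Orthonormal ℂ v)
    {c : ι → ℂ} {M : ℝ} (hc : ∀ i, ‖c i‖ ≤ M) : ∃ T : E →L[ℂ] F, IsSchmidtSum c u v T := by
  have hs : ∀ h, Summable fun n => (c n * inner ℂ (v n) h) • u n := fun h => by
    have h1 := (hu.orthogonalFamily.summable_iff_norm_sq_summable
      (fun n => c n * inner ℂ (v n) h)).2 ?_
    · simpa using h1
    · refine Summable.of_nonneg_of_le (fun n => by positivity) (fun n => ?_)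
        ((hv.inner_products_summable h).mul_left (M ^ 2))
      rw [norm_mul, mul_pow]
      gcongr
      exact hc n
  refine ⟨continuousLinearMapOfTendsto (l := Filter.atTop (α := Finset ι))
    (fun s => ∑ n ∈ s, c n • (innerSL ℂ (v n)).smulRight (u n))
    (f := fun h => ∑' n, (c n * inner ℂ (v n) h) • u n) ?_, hu, hv, fun h => (hs h).hasSum⟩
  rw [tendsto_pi_nhds]
  intro h
  refine (hs h).hasSum.congr' (.of_forall fun s => ?_)
  simp [mul_smul]

end Existence

/-! ### The calculus on scalars -/

section Scalar

theorem enorm_div_enorm_le_iff {a b : ℂ} (hb : b ≠ 0) {C : ℝ≥0∞} :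
    ‖a‖ₑ / ‖b‖ₑ ≤ C ↔ ‖a‖ₑ ≤ C * ‖b‖ₑ :=
  ENNReal.div_le_iff (by simpa using hb) enorm_ne_top

theorem norm_sub_le_of_lipConst_ne_top {f : ℝ≥0 → ℂ} (hf : lipConst f ≠ ∞) (x y : ℝ≥0) :
    ‖f x - f y‖ ≤ (lipConst f).toReal * |(x : ℝ) - y| := by
  by_cases hxy : x = y
  · simp [hxy]
  have h1 : ‖f x - f y‖ₑ / ‖(x : ℝ) - (y : ℝ)‖ₑ ≤ lipConst f :=
    le_iSup_of_le x (le_iSup_of_le y (le_iSup_of_le hxy le_rfl))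
  have h0 : (x : ℝ) - y ≠ 0 := sub_ne_zero.2 (by exact_mod_cast hxy)
  rw [ENNReal.div_le_iff (by simpa using h0) enorm_ne_top] at h1
  have h2 := ENNReal.toReal_mono (ENNReal.mul_ne_top hf enorm_ne_top) h1
  rwa [ENNReal.toReal_mul, toReal_enorm, toReal_enorm, Real.norm_eq_abs] at h2

theorem norm_ofReal_sub_mul_ofReal_sq (a b : ℝ) {ω : ℂ} (hω : ‖ω‖ = 1) :
    ‖(a : ℂ) - ω * b‖ ^ 2 = (a - b) ^ 2 + 2 * (1 - ω.re) * (a * b) := by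
  have h1 : ω.re * ω.re + ω.im * ω.im = 1 := by
    rw [← Complex.normSq_apply, Complex.normSq_eq_norm_sq, hω, one_pow]
  rw [← Complex.normSq_eq_norm_sq, Complex.normSq_apply]
  simp
  linear_combination b ^ 2 * h1

/-- For real `f` the form `|f s - ω f t|²` is a convex combination, with weights depending only on
`ω`, of `(f s - f t)²` and `(f s + f t)²`. -/
theorem scalarBound_of_real {f : ℝ≥0 → ℂ} {L : ℝ}
    (hf : ∀ x y : ℝ≥0, ‖f x - f y‖ ≤ L * |(x : ℝ) - y|) (h0 : f 0 = 0)
    (him : ∀ x, (f x).im = 0) : ScalarBound f (L ^ 2) := by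
  intro s t ω hω
  have hre : ∀ x, f x = ((f x).re : ℂ) := fun x => by
    apply Complex.ext <;> simp [him]
  have hn : ∀ x, |(f x).re| ≤ L * x := fun x => by
    have := hf x 0
    rw [h0, sub_zero, hre, Complex.norm_real] at this
    simpa using this
  have hd : |(f s).re - (f t).re| ≤ L * |(s : ℝ) - t| := by
    have := hf s t
    rwa [hre s, hre t, ← Complex.ofReal_sub, Complex.norm_real] at this
  have ha : |(f s).re + (f t).re| ≤ L * (s + t) :=
    (abs_add_le _ _).trans (by linarith [hn s, hn t])
  have hd2 := pow_le_pow_left₀ (abs_nonneg _) hd 2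
  have ha2 := pow_le_pow_left₀ (abs_nonneg _) ha 2
  rw [sq_abs, mul_pow, sq_abs] at hd2
  rw [sq_abs] at ha2
  rw [hre s, hre t, norm_ofReal_sub_mul_ofReal_sq _ _ hω, norm_ofReal_sub_mul_ofReal_sq _ _ hω]
  have h1 := abs_le.1 ((Complex.abs_re_le_norm ω).trans_eq hω)
  have h2 := mul_le_mul_of_nonneg_left hd2 (by linarith [h1.1] : 0 ≤ (1 + ω.re) / 2)
  have h3 := mul_le_mul_of_nonneg_left ha2 (by linarith [h1.2] : 0 ≤ (1 - ω.re) / 2)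
  nlinarith

/-- With `r = min s t`, the left side is at most `L (|s - t| + |1 - ω| r)`, whereas
`|s - ω t|² ≥ |s - t|² + |1 - ω|² r²`; the factor `2` comes from `(a + b)² ≤ 2 (a² + b²)`. -/
theorem scalarBound_two_mul {f : ℝ≥0 → ℂ} {L : ℝ}
    (hf : ∀ x y : ℝ≥0, ‖f x - f y‖ ≤ L * |(x : ℝ) - y|) (h0 : f 0 = 0) :
    ScalarBound f (2 * L ^ 2) := by
  intro s t ω hω
  have hn : ∀ x, ‖f x‖ ≤ L * x := fun x => by simpa [h0] using hf x 0
  have h1 : ‖1 - ω‖ ^ 2 = 2 * (1 - ω.re) := by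
    simpa using norm_ofReal_sub_mul_ofReal_sq 1 1 hω
  have hs : ‖f s - ω * f t‖ ≤ L * |(s : ℝ) - t| + ‖1 - ω‖ * (L * s) := by
    calc ‖f s - ω * f t‖ = ‖(1 - ω) * f s + ω * (f s - f t)‖ := by congr 1; ring
      _ ≤ ‖1 - ω‖ * ‖f s‖ + ‖f s - f t‖ := by
        refine (norm_add_le _ _).trans ?_
        rw [norm_mul, norm_mul, hω, one_mul]
      _ ≤ ‖1 - ω‖ * (L * s) + L * |(s : ℝ) - t| := by gcongr <;> simp [hn, hf]
      _ = _ := add_comm _ _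
  have ht : ‖f s - ω * f t‖ ≤ L * |(s : ℝ) - t| + ‖1 - ω‖ * (L * t) := by
    calc ‖f s - ω * f t‖ = ‖(1 - ω) * f t + (f s - f t)‖ := by congr 1; ring
      _ ≤ ‖1 - ω‖ * ‖f t‖ + ‖f s - f t‖ := by
        refine (norm_add_le _ _).trans ?_
        rw [norm_mul]
      _ ≤ ‖1 - ω‖ * (L * t) + L * |(s : ℝ) - t| := by gcongr <;> simp [hn, hf]
      _ = _ := add_comm _ _
  rw [norm_ofReal_sub_mul_ofReal_sq _ _ hω, ← h1]
  obtain ⟨r, hr0, hr, hrr⟩ : ∃ r : ℝ, 0 ≤ r ∧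
      ‖f s - ω * f t‖ ≤ L * |(s : ℝ) - t| + ‖1 - ω‖ * (L * r) ∧ r ^ 2 ≤ s * t := by
    rcases le_total (s : ℝ) t with h | h
    · exact ⟨s, s.2, hs, by nlinarith [s.2]⟩
    · exact ⟨t, t.2, ht, by nlinarith [t.2]⟩
  have h2 : ‖f s - ω * f t‖ ^ 2 ≤ (L * |(s : ℝ) - t| + ‖1 - ω‖ * (L * r)) ^ 2 :=
    pow_le_pow_left₀ (norm_nonneg _) hr 2
  have h3 := mul_le_mul_of_nonneg_left hrr (by positivity : 0 ≤ 2 * L ^ 2 * ‖1 - ω‖ ^ 2)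
  have h4 : (L * |(s : ℝ) - t| + ‖1 - ω‖ * (L * r)) ^ 2 ≤
      2 * ((L * |(s : ℝ) - t|) ^ 2 + (‖1 - ω‖ * (L * r)) ^ 2) := add_sq_le
  rw [mul_pow, sq_abs] at h4
  linarith

/-- The value of the calculus on the `1 × 1` matrix `z`, namely `f |z| · z / |z|`; it is `0` for
`z = 0`. -/
def radial (f : ℝ≥0 → ℂ) (z : ℂ) : ℂ := f ‖z‖₊ / (‖z‖ : ℂ) * z

theorem radial_ofReal {f : ℝ≥0 → ℂ} (h0 : f 0 = 0) (x : ℝ≥0) : radial f ((x : ℝ) : ℂ) = f x := by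
  by_cases hx : x = 0
  · simp [radial, hx, h0]
  · have : ((x : ℝ) : ℂ) ≠ 0 := by simpa using hx
    simp [radial, this]

theorem radial_mul_phase {f : ℝ≥0 → ℂ} {x : ℝ≥0} (hx : x ≠ 0) {ω : ℂ} (hω : ‖ω‖ = 1) :
    radial f ((x : ℝ) * ω) = f x * ω := by
  have h1 : ((x : ℝ) : ℂ) ≠ 0 := by simpa using hx
  have h2 : ‖((x : ℝ) : ℂ) * ω‖₊ = x := by
    ext; simp [hω]
  rw [radial, ← coe_nnnorm, h2]
  field_simp

/-- The path that runs along the real axis up to `1` and turns there by a right angle. -/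
def corner (x : ℝ≥0) : ℂ :=
  ((min (x : ℝ) 1 : ℝ) : ℂ) + ((max ((x : ℝ) - 1) 0 : ℝ) : ℂ) * Complex.I

theorem corner_zero : corner 0 = 0 := by simp [corner]

theorem norm_corner_sub_le (x y : ℝ≥0) : ‖corner x - corner y‖ ≤ |(x : ℝ) - y| := by
  refine abs_le_of_sq_le_sq' ?_ (abs_nonneg _) |>.2
  rw [sq_abs, ← Complex.normSq_eq_norm_sq, Complex.normSq_apply]
  simp only [corner, Complex.sub_re, Complex.add_re, Complex.ofReal_re, Complex.mul_re,
    Complex.I_re, Complex.I_im, Complex.ofReal_im, Complex.sub_im, Complex.add_im, Complex.mul_im]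
  rcases le_total (x : ℝ) 1 with hx | hx <;> rcases le_total (y : ℝ) 1 with hy | hy
  · rw [min_eq_left hx, min_eq_left hy, max_eq_right (by linarith), max_eq_right (by linarith)]
    nlinarith
  · rw [min_eq_left hx, min_eq_right hy, max_eq_right (by linarith), max_eq_left (by linarith)]
    nlinarith
  · rw [min_eq_right hx, min_eq_left hy, max_eq_left (by linarith), max_eq_right (by linarith)]
    nlinarith
  · rw [min_eq_right hx, min_eq_right hy, max_eq_left (by linarith), max_eq_left (by linarith)]
    nlinarith

theorem lipschitzWith_corner : LipschitzWith 1 corner := by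
  refine LipschitzWith.of_dist_le_mul fun x y => ?_
  rw [NNReal.coe_one, one_mul, dist_eq_norm, NNReal.dist_eq]
  exact norm_corner_sub_le x y

theorem lipConst_corner_le : lipConst corner ≤ 1 := by
  refine iSup_le fun x => iSup_le fun y => iSup_le fun hxy => ?_
  refine ENNReal.div_le_of_le_mul ?_
  rw [one_mul, ← ofReal_norm, ← ofReal_norm]
  exact ENNReal.ofReal_le_ofReal (norm_corner_sub_le x y)

open Filter Topology in
/-- Along `t ↦ (1 + t) exp (i t)`, which leaves `1` with velocity `1 + i`, the calculus of `corner`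
is `(1 + i t) exp (i t)`, with velocity `2 i`: the radial and the angular motion now have the same
direction, and lengths grow by the factor `2 / √2`. -/
theorem sqrt_two_le_of_radial_corner {C : ℝ}
    (hC : ∀ z w, ‖radial corner z - radial corner w‖ ≤ C * ‖z - w‖) : √2 ≤ C := by
  have he : HasDerivAt (fun t : ℝ => Complex.exp (t * Complex.I)) Complex.I 0 := by
    have h1 : HasDerivAt (fun t : ℝ => (t : ℂ) * Complex.I) Complex.I 0 := by
      simpa using (Complex.ofRealCLM.hasDerivAt (x := (0 : ℝ))).mul_const Complex.I
    simpa using h1.cexp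
  have h1 : HasDerivAt (fun t : ℝ => (1 + (t : ℂ) * Complex.I) * Complex.exp (t * Complex.I))
      (2 * Complex.I) 0 := by
    have h2 : HasDerivAt (fun t : ℝ => 1 + (t : ℂ) * Complex.I) Complex.I 0 := by
      simpa using ((Complex.ofRealCLM.hasDerivAt (x := (0 : ℝ))).mul_const Complex.I).const_add 1
    exact (h2.mul he).congr_deriv (by simp; ring)
  have h2 : HasDerivAt (fun t : ℝ => (1 + (t : ℂ)) * Complex.exp (t * Complex.I))
      (1 + Complex.I) 0 := by
    have h2 : HasDerivAt (fun t : ℝ => 1 + (t : ℂ)) 1 0 := by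
      simpa using (Complex.ofRealCLM.hasDerivAt (x := (0 : ℝ))).const_add 1
    exact (h2.mul he).congr_deriv (by simp)
  have l1 := h1.tendsto_slope_zero_right.norm
  have l2 := h2.tendsto_slope_zero_right.norm.const_mul C
  have hle : ‖(2 * Complex.I : ℂ)‖ ≤ C * ‖1 + Complex.I‖ := by
    refine le_of_tendsto_of_tendsto l1 l2 ?_
    filter_upwards [self_mem_nhdsWithin] with t (ht : 0 < t)
    obtain ⟨x, hxt⟩ : ∃ x : ℝ≥0, (x : ℝ) = 1 + t := ⟨⟨1 + t, by positivity⟩, rfl⟩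
    have hx : x ≠ 0 := by
      rw [Ne, ← NNReal.coe_eq_zero, hxt]
      positivity
    have e1 := radial_mul_phase (f := corner) hx (Complex.norm_exp_ofReal_mul_I t)
    have e2 : corner x = 1 + t * Complex.I := by
      simp [corner, hxt, ht.le]
    have e3 : radial corner 1 = 1 := by
      have := radial_ofReal corner_zero 1
      simpa [corner] using this
    have h3 := hC ((x : ℝ) * Complex.exp (t * Complex.I)) 1
    rw [e1, e2, e3, hxt] at h3
    have h4 := mul_le_mul_of_nonneg_left h3 (norm_nonneg (t⁻¹ : ℝ))
    simp only [norm_smul, zero_add, Complex.ofReal_zero, zero_mul, Complex.exp_zero, add_zero,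
      one_mul, Complex.ofReal_add, Complex.ofReal_one] at h4 ⊢
    linarith
  have h5 : ‖(1 + Complex.I : ℂ)‖ = √2 := by
    rw [Complex.norm_def, Complex.normSq_apply]; norm_num
  rw [h5, norm_mul, Complex.norm_I, mul_one, Complex.norm_ofNat] at hle
  have h6 : √2 * √2 = 2 := Real.mul_self_sqrt (by norm_num)
  have h7 : 0 < √2 := by positivity
  exact le_of_mul_le_mul_right (h6.trans_le hle) h7

/-- The three assertions about a Lipschitz constant `G f` of the calculus follow from a lower
bound by, and an upper bound in terms of, the calculus on `1 × 1` matrices. -/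
theorem lipschitz_constants_of_bounds (G : (ℝ≥0 → ℂ) → ℝ≥0∞)
    (hup : ∀ f K, 0 ≤ K → ScalarBound f K → f 0 = 0 → G f ≤ ENNReal.ofReal √K)
    (hlow : ∀ f, f 0 = 0 → ∀ z w, z ≠ w → ‖radial f z - radial f w‖ₑ / ‖z - w‖ₑ ≤ G f) :
    (∀ f : ℝ≥0 → ℂ, Continuous f → f 0 = 0 → G f ≤ ENNReal.ofReal (√2) * lipConst f) ∧
    (∀ C : ℝ≥0, (∀ f : ℝ≥0 → ℂ, (∃ L : ℝ≥0, LipschitzWith L f) → f 0 = 0 →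
      G f ≤ (C : ℝ≥0∞) * lipConst f) → √2 ≤ (C : ℝ)) ∧
    (∀ f : ℝ≥0 → ℂ, Continuous f → f 0 = 0 → (∀ x, (f x).im = 0) → G f = lipConst f) := by
  refine ⟨fun f _ h0 => ?_, fun C hC => ?_, fun f _ h0 him => le_antisymm ?_ ?_⟩
  · by_cases hf : lipConst f = ∞
    · rw [hf, ENNReal.mul_top (by simp)]
      exact le_top
    · have h1 := hup f _ (by positivity) (scalarBound_two_mul
        (norm_sub_le_of_lipConst_ne_top hf) h0) h0
      rwa [Real.sqrt_mul (by norm_num), Real.sqrt_sq ENNReal.toReal_nonneg,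
        ENNReal.ofReal_mul (by positivity), ENNReal.ofReal_toReal hf] at h1
  · refine sqrt_two_le_of_radial_corner fun z w => ?_
    by_cases hzw : z = w
    · simp [hzw]
    have h1 := (hlow corner corner_zero z w hzw).trans
      ((hC corner ⟨1, lipschitzWith_corner⟩ corner_zero).trans
        (mul_le_mul_right lipConst_corner_le _))
    rw [mul_one, enorm_div_enorm_le_iff (sub_ne_zero.2 hzw)] at h1
    simpa using ENNReal.toReal_mono (ENNReal.mul_ne_top ENNReal.coe_ne_top enorm_ne_top) h1
  · by_cases hf : lipConst f = ∞
    · rw [hf]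
      exact le_top
    · have h1 := hup f _ (by positivity) (scalarBound_of_real
        (norm_sub_le_of_lipConst_ne_top hf) h0 him) h0
      rwa [Real.sqrt_sq ENNReal.toReal_nonneg, ENNReal.ofReal_toReal hf] at h1
  · refine iSup_le fun x => iSup_le fun y => iSup_le fun hxy => ?_
    have h1 := hlow f h0 ((x : ℝ) : ℂ) ((y : ℝ) : ℂ) (by exact_mod_cast hxy)
    rwa [radial_ofReal h0, radial_ofReal h0, ← Complex.ofReal_sub, ← ofReal_norm ((_ : ℝ) : ℂ),
      Complex.norm_real, ofReal_norm] at h1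

end Scalar

/-! ### Operators of rank one -/

section RankOne

variable {E F : Type*} [NormedAddCommGroup E] [InnerProductSpace ℂ E]
  [NormedAddCommGroup F] [InnerProductSpace ℂ F]

/-- The rank one operator `z · e' ⊗ e`, that is `h ↦ z ⟨h, e⟩ e'`. -/
def rankOneSMul (z : ℂ) (e' : F) (e : E) : E →L[ℂ] F := (innerSL ℂ e).smulRight (z • e')

theorem rankOneSMul_apply (z : ℂ) (e' : F) (e h : E) :
    rankOneSMul z e' e h = (z * inner ℂ e h) • e' := by
  simp [rankOneSMul, smul_smul, mul_comm]

theorem rankOneSMul_sub (z w : ℂ) (e' : F) (e : E) :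
    rankOneSMul z e' e - rankOneSMul w e' e = rankOneSMul (z - w) e' e := by
  ext h
  simp [rankOneSMul_apply, sub_mul, sub_smul]

theorem isCompactOperator_rankOneSMul (z : ℂ) (e' : F) (e : E) :
    IsCompactOperator (rankOneSMul z e' e) :=
  (isCompactOperator_of_locallyCompactSpace_dom (innerSL ℂ e)).clm_comp
    (ContinuousLinearMap.toSpanSingleton ℂ (z • e'))

theorem hsSq_rankOneSMul [CompleteSpace E] [CompleteSpace F] (z : ℂ) {e' : F} {e : E}
    (he' : ‖e'‖ = 1) (he : ‖e‖ = 1) : hsSq (rankOneSMul z e' e) = ‖z‖ₑ ^ 2 := by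
  obtain ⟨w, b, -⟩ := exists_hilbertBasis ℂ E
  rw [hsSq_eq b]
  have h1 : ∀ i, ‖rankOneSMul z e' e (b i)‖ₑ ^ 2 = ‖z‖ₑ ^ 2 * ‖inner ℂ (b i) e‖ₑ ^ 2 := by
    intro i
    rw [rankOneSMul_apply, enorm_smul, ← ofReal_norm e', he', ENNReal.ofReal_one, mul_one,
      enorm_mul, mul_pow, ← inner_conj_symm, RCLike.enorm_conj]
  simp_rw [h1]
  rw [ENNReal.tsum_mul_left, tsum_enorm_inner_sq, ← ofReal_norm e, he]
  simp

/-- Whichever singular value decomposition of `z · e' ⊗ e` is used, the calculus gives the same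
result: all singular values are `0` or `|z|`, so `f` acts on them as multiplication by the constant
`f |z| / |z|`. For `z = 0` this constant is the junk value `0`, which is correct since all `σ n`
vanish. -/
theorem IsSchmidtSum.eq_radial {ι : Type*} {σ : ι → ℝ≥0} {u : ι → F} {v : ι → E}
    {f : ℝ≥0 → ℂ} (h0 : f 0 = 0) {z : ℂ} {e' : F} {e : E} (he' : ‖e'‖ = 1) {T : E →L[ℂ] F}
    (hA : IsSchmidtSum (fun n => ((σ n : ℝ) : ℂ)) u v (rankOneSMul z e' e))
    (he : ‖e‖ = 1) (hT : IsSchmidtSum (fun n => f (σ n)) u v T) :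
    T = rankOneSMul (radial f z) e' e := by
  have hσ : ∀ n, σ n = 0 ∨ σ n = ‖z‖₊ := by
    intro n
    by_cases hn : σ n = 0
    · exact Or.inl hn
    right
    have hn' : ((σ n : ℝ) : ℂ) ≠ 0 := by simpa using hn
    have h1 := hA.apply_right n
    have h2 := hA.inner_apply n e
    rw [rankOneSMul_apply] at h1 h2
    rw [inner_smul_right, inner_self_eq_norm_sq_to_K, he] at h2
    have h3 := congrArg (fun x => inner ℂ x e') h1
    simp only [inner_smul_left, inner_self_eq_norm_sq_to_K, he', map_mul, inner_conj_symm,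
      Complex.conj_ofReal] at h3
    have hv0 : inner ℂ (v n) e ≠ 0 := by
      intro h
      rw [← inner_conj_symm, h, map_zero, mul_zero, zero_smul] at h1
      have := smul_eq_zero.1 h1.symm
      rcases this with h | h
      · exact hn' h
      · exact hA.1.ne_zero n h
    have h4 : ((σ n : ℝ) : ℂ) ^ 2 = (‖z‖ : ℂ) ^ 2 := by
      refine mul_right_cancel₀ hv0 ?_
      rw [← Complex.mul_conj']
      norm_num at h2 h3
      linear_combination (-((σ n : ℝ) : ℂ)) * h2 - z * h3
    have h5 : ((σ n : ℝ)) ^ 2 = ‖z‖ ^ 2 := by exact_mod_cast h4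
    ext
    simpa using (pow_left_inj₀ (σ n).2 (norm_nonneg z) two_ne_zero).1 h5
  have hf : ∀ n, f (σ n) = f ‖z‖₊ / (‖z‖ : ℂ) * ((σ n : ℝ) : ℂ) := by
    intro n
    rcases hσ n with h | h
    · simp [h, h0]
    · by_cases hz : z = 0
      · simp [h, hz, h0]
      · have : ((‖z‖ : ℝ) : ℂ) ≠ 0 := by simpa using hz
        rw [h, coe_nnnorm]
        field_simp
  ext h
  refine (hT.2.2 h).unique ?_
  have h1 := (hA.2.2 h).const_smul (f ‖z‖₊ / (‖z‖ : ℂ))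
  rw [rankOneSMul_apply] at h1 ⊢
  simpa only [hf, smul_smul, radial, mul_assoc] using h1

end RankOne

/-! ### Hilbert–Schmidt operators -/

section Operator

variable {H : Type*} [NormedAddCommGroup H] [InnerProductSpace ℂ H]

theorem isCalc_opCalc {f : ℝ≥0 → ℂ} {A : H →L[ℂ] H} (h : ∃ T, IsCalc f A T) :
    IsCalc f A (opCalc f A) := by
  rw [opCalc, dif_pos h]
  exact h.choose_spec

theorem opCalc_rankOneSMul {f : ℝ≥0 → ℂ} (h0 : f 0 = 0) (z : ℂ) {e : H} (he : ‖e‖ = 1) :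
    opCalc f (rankOneSMul z e e) = rankOneSMul (radial f z) e e := by
  have hex : ∃ T, IsCalc f (rankOneSMul z e e) T := by
    obtain ⟨θ, hθ, hz⟩ : ∃ θ : ℂ, ‖θ‖ = 1 ∧ z = ‖z‖ * θ := by
      by_cases hz : z = 0
      · exact ⟨1, by simp [hz]⟩
      · have : ((‖z‖ : ℝ) : ℂ) ≠ 0 := by simpa using hz
        exact ⟨z / ‖z‖, by simp [hz], by field_simp⟩
    refine ⟨rankOneSMul (f ‖z‖₊ * θ) e e, Unit, fun _ => ‖z‖₊, fun _ => θ • e, fun _ => e,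
      ⟨⟨fun _ => by simp [norm_smul, hθ, he], fun i j hij => absurd rfl hij⟩,
        ⟨fun _ => he, fun i j hij => absurd rfl hij⟩, fun h => ?_⟩, fun h => ?_⟩
    · convert hasSum_unique (α := H) (β := Unit) _ using 1
      rw [rankOneSMul_apply, smul_smul, coe_nnnorm]
      nth_rewrite 1 [hz]
      congr 1
      ring
    · convert hasSum_unique (α := H) (β := Unit) _ using 1
      rw [rankOneSMul_apply, smul_smul]
      congr 1
      ring
  obtain ⟨ι, σ, u, v, hA, hT⟩ := isCalc_opCalc hex
  exact IsSchmidtSum.eq_radial h0 he hA he ⟨hA.1, hA.2.1, hT⟩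

variable [CompleteSpace H]

theorem hsNorm_eq_hsSq (T : H →L[ℂ] H) : hsNorm T = hsSq T ^ (1 / 2 : ℝ) := rfl

theorem exists_isCalc [TopologicalSpace.SeparableSpace H] {f : ℝ≥0 → ℂ} {K : ℝ}
    (hf : ScalarBound f K) (h0 : f 0 = 0) {A : H →L[ℂ] H} (hA : IsCompactOperator A) :
    ∃ T, IsCalc f A T := by
  obtain ⟨ι, σ, u, v, hs⟩ := exists_isSchmidtSum hA
  have : Countable ι := hs.1.countable
  have hb : ∀ i, ‖f (σ i)‖ ≤ √K * ‖A‖ := by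
    intro i
    have h1 : ‖((σ i : ℝ) : ℂ)‖ ≤ ‖A‖ := by
      have h2 := A.le_opNorm (v i)
      rwa [hs.apply_right, norm_smul, hs.1.1, hs.2.1.1, mul_one, mul_one] at h2
    have h3 := Real.sqrt_le_sqrt (hf.norm_sq_le h0 (σ i))
    rw [Real.sqrt_sq (norm_nonneg _), Real.sqrt_mul' _ (by positivity),
      Real.sqrt_sq (norm_nonneg _)] at h3
    exact h3.trans (by gcongr)
  obtain ⟨T, hT⟩ := exists_isSchmidtSum_of_bounded hs.1 hs.2.1 hb
  exact ⟨T, ι, σ, u, v, hs, hT.2.2⟩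

theorem opLipConst_le [TopologicalSpace.SeparableSpace H] {f : ℝ≥0 → ℂ} {K : ℝ} (hK : 0 ≤ K)
    (hf : ScalarBound f K) (h0 : f 0 = 0) : opLipConst H f ≤ ENNReal.ofReal √K := by
  refine iSup_le fun A => iSup_le fun B => iSup_le fun hA => iSup_le fun hB => iSup_le fun _ =>
    ENNReal.div_le_of_le_mul ?_
  obtain ⟨ι, σ, u, v, hA1, hS⟩ := isCalc_opCalc (exists_isCalc hf h0 hA.1)
  obtain ⟨κ, τ, x, y, hB1, hT⟩ := isCalc_opCalc (exists_isCalc hf h0 hB.1)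
  have h1 := hsSq_sub_le hK hf h0 hA1 ⟨hA1.1, hA1.2.1, hS⟩ hB1 ⟨hB1.1, hB1.2.1, hT⟩
  rw [hsNorm_eq_hsSq, hsNorm_eq_hsSq, Real.sqrt_eq_rpow,
    ← ENNReal.ofReal_rpow_of_nonneg hK (by norm_num),
    ← ENNReal.mul_rpow_of_nonneg _ _ (by norm_num)]
  exact ENNReal.rpow_le_rpow h1 (by norm_num)

theorem hsNorm_rankOneSMul (z : ℂ) {e' e : H} (he' : ‖e'‖ = 1) (he : ‖e‖ = 1) :
    hsNorm (rankOneSMul z e' e) = ‖z‖ₑ := by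
  rw [hsNorm_eq_hsSq, hsSq_rankOneSMul z he' he, ← ENNReal.rpow_natCast, ← ENNReal.rpow_mul]
  norm_num

theorem le_opLipConst [Nontrivial H] {f : ℝ≥0 → ℂ} (h0 : f 0 = 0) {z w : ℂ} (hzw : z ≠ w) :
    ‖radial f z - radial f w‖ₑ / ‖z - w‖ₑ ≤ opLipConst H f := by
  obtain ⟨e, he⟩ := exists_norm_eq H (zero_le_one' ℝ)
  have hs : ∀ z, IsHilbertSchmidt (rankOneSMul z e e) := fun z =>
    ⟨isCompactOperator_rankOneSMul z e e, by rw [hsNorm_rankOneSMul z he he]; exact enorm_lt_top⟩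
  have hne : rankOneSMul z e e ≠ rankOneSMul w e e := fun h => by
    rw [← sub_eq_zero, rankOneSMul_sub] at h
    have h1 := hsNorm_rankOneSMul (z - w) he he
    rw [h, ← sub_self (rankOneSMul 0 e e), rankOneSMul_sub, sub_zero,
      hsNorm_rankOneSMul _ he he, enorm_zero] at h1
    exact hzw (sub_eq_zero.1 (enorm_eq_zero.1 h1.symm))
  refine le_iSup_of_le _ (le_iSup_of_le _ (le_iSup_of_le (hs z) (le_iSup_of_le (hs w)
    (le_iSup_of_le hne ?_))))
  rw [opCalc_rankOneSMul h0 z he, opCalc_rankOneSMul h0 w he, rankOneSMul_sub, rankOneSMul_sub,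
    hsNorm_rankOneSMul _ he he, hsNorm_rankOneSMul _ he he]

end Operator

/-! ### Matrices with the Frobenius norm -/

section Matrices

variable {m n : ℕ}

/-- The operator between Euclidean spaces given by a matrix. -/
def matrixOp (A : Matrix (Fin m) (Fin n) ℂ) :
    EuclideanSpace ℂ (Fin n) →L[ℂ] EuclideanSpace ℂ (Fin m) :=
  LinearMap.toContinuousLinearMap (Matrix.toEuclideanLin A)

theorem matrixOp_apply (A : Matrix (Fin m) (Fin n) ℂ) (h : EuclideanSpace ℂ (Fin n)) (i : Fin m) :
    matrixOp A h i = (A.mulVec h.ofLp) i := rfl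

theorem matrixOp_sub (A B : Matrix (Fin m) (Fin n) ℂ) :
    matrixOp (A - B) = matrixOp A - matrixOp B := by
  simp [matrixOp]

theorem matrixOp_injective :
    Function.Injective (matrixOp : Matrix (Fin m) (Fin n) ℂ → _) :=
  LinearMap.toContinuousLinearMap.injective.comp Matrix.toEuclideanLin.injective

theorem matrixOp_single (A : Matrix (Fin m) (Fin n) ℂ) (i : Fin m) (j : Fin n) :
    matrixOp A (EuclideanSpace.single j 1) i = A i j := by
  rw [matrixOp_apply]
  simp

open scoped Matrix.Norms.Frobenius in
theorem enorm_sq_eq_hsSq (A : Matrix (Fin m) (Fin n) ℂ) : ‖A‖ₑ ^ 2 = hsSq (matrixOp A) := by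
  rw [hsSq_eq (EuclideanSpace.basisFun (Fin n) ℂ).toHilbertBasis, tsum_fintype]
  simp only [enorm_sq_eq_ofReal]
  rw [← ENNReal.ofReal_sum_of_nonneg (fun _ _ => by positivity), Matrix.frobenius_norm_def,
    ← Real.sqrt_eq_rpow, Real.sq_sqrt (by positivity), Finset.sum_comm]
  congr 1
  refine Finset.sum_congr rfl fun j _ => ?_
  rw [EuclideanSpace.norm_sq_eq]
  simp [matrixOp_single]

/-- The `j`-th column of a square matrix as a vector of Euclidean space. -/
def euclideanCol (U : Matrix (Fin n) (Fin n) ℂ) (j : Fin n) : EuclideanSpace ℂ (Fin n) :=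
  WithLp.toLp 2 fun i => U i j

theorem inner_euclideanCol (U : Matrix (Fin n) (Fin n) ℂ) (j : Fin n)
    (h : EuclideanSpace ℂ (Fin n)) :
    inner ℂ (euclideanCol U j) h = (U.conjTranspose.mulVec h.ofLp) j := by
  simp [euclideanCol, PiLp.inner_apply, Matrix.mulVec, dotProduct, mul_comm]

theorem orthonormal_euclideanCol {U : Matrix (Fin n) (Fin n) ℂ}
    (hU : U ∈ Matrix.unitaryGroup (Fin n) ℂ) : Orthonormal ℂ (euclideanCol U) := by
  rw [orthonormal_iff_ite]
  intro i j
  have h1 := congrFun (congrFun (Matrix.mem_unitaryGroup_iff'.1 hU) i) j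
  rw [Matrix.one_apply] at h1
  rw [inner_euclideanCol, ← h1]
  rfl

/-- The sum runs over the positions `(i, i)` of the rectangular main diagonal, encoded as pairs of
indices with equal values. -/
theorem isSchmidtSum_matrixOp {U : Matrix (Fin m) (Fin m) ℂ} {V : Matrix (Fin n) (Fin n) ℂ}
    (hU : U ∈ Matrix.unitaryGroup (Fin m) ℂ) (hV : V ∈ Matrix.unitaryGroup (Fin n) ℂ)
    (d : ℕ → ℂ) :
    IsSchmidtSum (fun p : {p : Fin m × Fin n // (p.1 : ℕ) = p.2} => d p.1.1)
      (fun p => euclideanCol U p.1.1) (fun p => euclideanCol V p.1.2)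
      (matrixOp (U * rectDiag m n d * V.conjTranspose)) := by
  refine ⟨(orthonormal_euclideanCol hU).comp _ ?_, (orthonormal_euclideanCol hV).comp _ ?_,
    fun h => ?_⟩
  · rintro ⟨⟨i, j⟩, hp⟩ ⟨⟨i', j'⟩, hp'⟩ (rfl : i = i')
    simp only [Subtype.mk.injEq, Prod.mk.injEq, true_and]
    exact Fin.ext (hp.symm.trans hp')
  · rintro ⟨⟨i, j⟩, hp⟩ ⟨⟨i', j'⟩, hp'⟩ (rfl : j = j')
    simp only [Subtype.mk.injEq, Prod.mk.injEq, and_true]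
    exact Fin.ext (hp.trans hp'.symm)
  · have key : matrixOp (U * rectDiag m n d * V.conjTranspose) h =
        ∑ p : {p : Fin m × Fin n // (p.1 : ℕ) = p.2},
          (d p.1.1 * inner ℂ (euclideanCol V p.1.2) h) • euclideanCol U p.1.1 := by
      ext a
      rw [matrixOp_apply, ← Matrix.mulVec_mulVec, ← Matrix.mulVec_mulVec]
      simp only [inner_euclideanCol]
      generalize V.conjTranspose.mulVec h.ofLp = g
      rw [WithLp.ofLp_sum, Finset.sum_apply,
        ← Finset.sum_subtype (Finset.univ.filter fun p : Fin m × Fin n => (p.1 : ℕ) = p.2)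
          (p := fun p : Fin m × Fin n => (p.1 : ℕ) = p.2) (by simp)
          (fun p => ((d p.1 * g p.2) • euclideanCol U p.1).ofLp a),
        Finset.sum_filter, Fintype.sum_prod_type]
      simp only [Matrix.mulVec, dotProduct, rectDiag, Matrix.of_apply, Finset.mul_sum]
      refine Finset.sum_congr rfl fun i _ => Finset.sum_congr rfl fun j _ => ?_
      split_ifs
      · simp [euclideanCol, mul_comm]
      · simp
    rw [key]
    exact hasSum_fintype _

/-- The Schmidt systems of the operator, enumerated first, are completed to orthonormal bases of
both spaces, whose vectors are the columns of `U` and `V`. -/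
theorem exists_isMatrixSVD (A : Matrix (Fin m) (Fin n) ℂ) : ∃ U σ V, IsMatrixSVD A U σ V := by
  obtain ⟨ι, σ, u, v, hA⟩ := exists_isSchmidtSum (A := matrixOp A)
    (isCompactOperator_of_locallyCompactSpace_dom _)
  have hli := hA.2.1.linearIndependent
  have : Finite ι := hli.finite
  have : Fintype ι := Fintype.ofFinite ι
  have hn : Fintype.card ι ≤ n := by simpa using hli.fintype_card_le_finrank
  have hm : Fintype.card ι ≤ m := by simpa using hA.1.linearIndependent.fintype_card_le_finrank
  let e := (Fintype.equivFin ι).symm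
  have hext : ∀ {l : ℕ} (hl : Fintype.card ι ≤ l) {w : ι → EuclideanSpace ℂ (Fin l)},
      Orthonormal ℂ w → ∃ b : OrthonormalBasis (Fin l) ℂ (EuclideanSpace ℂ (Fin l)),
        ∀ (k : Fin l) (hk : (k : ℕ) < Fintype.card ι), b k = w (e ⟨k, hk⟩) := by
    intro l hl w hw
    obtain ⟨b, hb⟩ := Orthonormal.exists_orthonormalBasis_extension_of_card_eq
      (𝕜 := ℂ) (E := EuclideanSpace ℂ (Fin l)) (ι := Fin l) (by simp)
      (v := fun k => if hk : (k : ℕ) < Fintype.card ι then w (e ⟨k, hk⟩) else 0)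
      (s := {k | (k : ℕ) < Fintype.card ι}) (by
        refine (congrArg (Orthonormal ℂ) (funext fun k => ?_)).mpr
          (hw.comp (fun k : {k : Fin l | (k : ℕ) < Fintype.card ι} => e ⟨k.1, k.2⟩) ?_)
        · have : ((k : Fin l) : ℕ) < Fintype.card ι := k.2
          simp [Set.domRestrict, this]
        · intro k k' h
          have := e.injective h
          simpa [Subtype.ext_iff, Fin.ext_iff] using this)
    exact ⟨b, fun k hk => by rw [hb k hk, dif_pos hk]⟩
  obtain ⟨bU, hbU⟩ := hext hm hA.1
  obtain ⟨bV, hbV⟩ := hext hn hA.2.1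
  let M : ∀ {l : ℕ}, OrthonormalBasis (Fin l) ℂ (EuclideanSpace ℂ (Fin l)) →
      Matrix (Fin l) (Fin l) ℂ := fun b => Matrix.of fun i j => b j i
  have hM : ∀ {l : ℕ} (b : OrthonormalBasis (Fin l) ℂ (EuclideanSpace ℂ (Fin l))),
      M b ∈ Matrix.unitaryGroup (Fin l) ℂ := fun b =>
    (EuclideanSpace.basisFun _ ℂ).toMatrix_orthonormalBasis_mem_unitary b
  refine ⟨M bU, fun k => if hk : k < Fintype.card ι then σ (e ⟨k, hk⟩) else 0, M bV,
    hM bU, hM bV, ?_⟩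
  rw [← Matrix.mul_one A, ← Matrix.mem_unitaryGroup_iff.1 (hM bV), ← Matrix.mul_assoc]
  congr 1
  ext i j
  have h1 : (A * M bV) i j = matrixOp A (bV j) i := rfl
  rw [h1, Matrix.mul_apply]
  by_cases hj : (j : ℕ) < Fintype.card ι
  · have h2 : ∀ k : Fin m, (k : ℕ) = j ↔ k = ⟨j, hj.trans_le hm⟩ := fun k => by
      rw [Fin.ext_iff]
    simp only [rectDiag, Matrix.of_apply, h2, mul_ite, mul_zero]
    rw [hbV j hj, hA.apply_right, Finset.sum_ite_eq']
    simp [hj, M, hbU ⟨j, hj.trans_le hm⟩ hj, mul_comm]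
  · rw [hA.apply_eq_zero]
    · rw [Finset.sum_eq_zero]
      · rfl
      · intro k _
        by_cases hk : (k : ℕ) = j
        · simp [rectDiag, hk, hj]
        · simp [rectDiag, hk]
    · intro i
      have h3 := hbV ⟨(e.symm i : ℕ), (e.symm i).2.trans_le hn⟩ (e.symm i).2
      simp only [Fin.eta, Equiv.apply_symm_apply] at h3
      rw [← h3]
      refine bV.orthonormal.2 fun h => hj ?_
      rw [← h]
      exact (e.symm i).2

theorem isMatrixCalc_matrixCalc (f : ℝ≥0 → ℂ) (A : Matrix (Fin m) (Fin n) ℂ) :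
    IsMatrixCalc f A (matrixCalc f A) := by
  obtain ⟨U, σ, V, h⟩ := exists_isMatrixSVD A
  have hex : ∃ B, IsMatrixCalc f A B := ⟨_, U, σ, V, h, rfl⟩
  rw [matrixCalc, dif_pos hex]
  exact hex.choose_spec

theorem IsMatrixCalc.exists_isSchmidtSum {f : ℝ≥0 → ℂ} {A B : Matrix (Fin m) (Fin n) ℂ}
    (h : IsMatrixCalc f A B) : ∃ (ι : Type) (σ : ι → ℝ≥0) (u : ι → EuclideanSpace ℂ (Fin m))
      (v : ι → EuclideanSpace ℂ (Fin n)),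
      IsSchmidtSum (fun k => ((σ k : ℝ) : ℂ)) u v (matrixOp A) ∧
        IsSchmidtSum (fun k => f (σ k)) u v (matrixOp B) := by
  obtain ⟨U, σ, V, ⟨hU, hV, hA⟩, hB⟩ := h
  refine ⟨{p : Fin m × Fin n // (p.1 : ℕ) = p.2}, fun p => σ p.1.1,
    fun p => euclideanCol U p.1.1, fun p => euclideanCol V p.1.2, ?_, ?_⟩
  · rw [hA]
    exact isSchmidtSum_matrixOp hU hV (fun k => ((σ k : ℝ) : ℂ))
  · rw [hB]
    exact isSchmidtSum_matrixOp hU hV (fun k => f (σ k))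

open scoped Matrix.Norms.Frobenius in
theorem enorm_eq_hsSq_rpow (A : Matrix (Fin m) (Fin n) ℂ) :
    ‖A‖ₑ = hsSq (matrixOp A) ^ (1 / 2 : ℝ) := by
  rw [← enorm_sq_eq_hsSq, ← ENNReal.rpow_natCast, ← ENNReal.rpow_mul]
  norm_num

theorem matrixLipConst_le {f : ℝ≥0 → ℂ} {K : ℝ} (hK : 0 ≤ K)
    (hf : ScalarBound f K) (h0 : f 0 = 0) : matrixLipConst m n f ≤ ENNReal.ofReal √K := by
  refine iSup_le fun A => iSup_le fun B => iSup_le fun _ => ENNReal.div_le_of_le_mul ?_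
  obtain ⟨ι, σ, u, v, hA, hS⟩ := (isMatrixCalc_matrixCalc f A).exists_isSchmidtSum
  obtain ⟨κ, τ, x, y, hB, hT⟩ := (isMatrixCalc_matrixCalc f B).exists_isSchmidtSum
  have h1 := hsSq_sub_le hK hf h0 hA hS hB hT
  rw [enorm_eq_hsSq_rpow, enorm_eq_hsSq_rpow, matrixOp_sub, matrixOp_sub, Real.sqrt_eq_rpow,
    ← ENNReal.ofReal_rpow_of_nonneg hK (by norm_num),
    ← ENNReal.mul_rpow_of_nonneg _ _ (by norm_num)]
  exact ENNReal.rpow_le_rpow h1 (by norm_num)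

theorem matrixOp_matrix_single (i : Fin m) (j : Fin n) (z : ℂ) :
    matrixOp (Matrix.single i j z) =
      rankOneSMul z (EuclideanSpace.single i 1) (EuclideanSpace.single j 1) := by
  ext h k
  rw [matrixOp_apply, rankOneSMul_apply]
  by_cases hk : k = i
  · subst hk
    simp [EuclideanSpace.inner_single_left, Matrix.mulVec, dotProduct, Matrix.single_apply]
  · simp [Matrix.single_mulVec, hk]

theorem single_sub_single (i : Fin m) (j : Fin n) (z w : ℂ) :
    Matrix.single i j z - Matrix.single i j w = Matrix.single i j (z - w) :=
  matrixOp_injective (by simp only [matrixOp_sub, matrixOp_matrix_single, rankOneSMul_sub])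

theorem matrixCalc_single {f : ℝ≥0 → ℂ} (h0 : f 0 = 0) (i : Fin m) (j : Fin n) (z : ℂ) :
    matrixCalc f (Matrix.single i j z) = Matrix.single i j (radial f z) := by
  obtain ⟨ι, σ, u, v, hA, hS⟩ :=
    (isMatrixCalc_matrixCalc f (Matrix.single i j z)).exists_isSchmidtSum
  apply matrixOp_injective
  rw [matrixOp_matrix_single] at hA ⊢
  exact hA.eq_radial h0 (by simp) (by simp) hS

open scoped Matrix.Norms.Frobenius in
theorem enorm_matrix_single (i : Fin m) (j : Fin n) (z : ℂ) : ‖Matrix.single i j z‖ₑ = ‖z‖ₑ := by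
  rw [enorm_eq_hsSq_rpow, matrixOp_matrix_single, hsSq_rankOneSMul z (by simp) (by simp),
    ← ENNReal.rpow_natCast, ← ENNReal.rpow_mul]
  norm_num

theorem le_matrixLipConst (hm : 0 < m) (hn : 0 < n) {f : ℝ≥0 → ℂ} (h0 : f 0 = 0) {z w : ℂ}
    (hzw : z ≠ w) : ‖radial f z - radial f w‖ₑ / ‖z - w‖ₑ ≤ matrixLipConst m n f := by
  have hne : Matrix.single (⟨0, hm⟩ : Fin m) (⟨0, hn⟩ : Fin n) z ≠
      Matrix.single ⟨0, hm⟩ ⟨0, hn⟩ w :=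
    fun h => hzw (by simpa using congrFun (congrFun h ⟨0, hm⟩) ⟨0, hn⟩)
  refine le_iSup_of_le _ (le_iSup_of_le _ (le_iSup_of_le hne ?_))
  rw [matrixCalc_single h0, matrixCalc_single h0, single_sub_single, single_sub_single,
    enorm_matrix_single, enorm_matrix_single]

end Matrices

end SingularValueCalculus

end

theorem theorem1 :
    -- complex matrices of arbitrary nonempty size, Frobenius norm
    (∀ m n : ℕ, 0 < m → 0 < n →
      (∀ f : ℝ≥0 → ℂ, Continuous f → f 0 = 0 →
        SingularValueCalculus.matrixLipConst m n f ≤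
          ENNReal.ofReal (√2) * SingularValueCalculus.lipConst f) ∧
      (∀ C : ℝ≥0,
        (∀ f : ℝ≥0 → ℂ, (∃ L : ℝ≥0, LipschitzWith L f) → f 0 = 0 →
          SingularValueCalculus.matrixLipConst m n f ≤
            (C : ℝ≥0∞) * SingularValueCalculus.lipConst f) →
        √2 ≤ (C : ℝ)) ∧
      (∀ f : ℝ≥0 → ℂ, Continuous f → f 0 = 0 → (∀ x, (f x).im = 0) →
        SingularValueCalculus.matrixLipConst m n f = SingularValueCalculus.lipConst f)) ∧
    -- Hilbert–Schmidt operators on a separable nonzero Hilbert space of any dimension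
    (∀ (H : Type*) [NormedAddCommGroup H] [InnerProductSpace ℂ H] [CompleteSpace H]
        [TopologicalSpace.SeparableSpace H] [Nontrivial H],
      (∀ f : ℝ≥0 → ℂ, Continuous f → f 0 = 0 →
        SingularValueCalculus.opLipConst H f ≤
          ENNReal.ofReal (√2) * SingularValueCalculus.lipConst f) ∧
      (∀ C : ℝ≥0,
        (∀ f : ℝ≥0 → ℂ, (∃ L : ℝ≥0, LipschitzWith L f) → f 0 = 0 →
          SingularValueCalculus.opLipConst H f ≤
            (C : ℝ≥0∞) * SingularValueCalculus.lipConst f) →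
        √2 ≤ (C : ℝ)) ∧
      (∀ f : ℝ≥0 → ℂ, Continuous f → f 0 = 0 → (∀ x, (f x).im = 0) →
        SingularValueCalculus.opLipConst H f = SingularValueCalculus.lipConst f)) := by
  refine ⟨fun m n hm hn => ?_, fun H _ _ _ _ _ => ?_⟩
  · exact SingularValueCalculus.lipschitz_constants_of_bounds _
      (fun f K hK hf h0 => SingularValueCalculus.matrixLipConst_le hK hf h0)
      (fun f h0 z w hzw => SingularValueCalculus.le_matrixLipConst hm hn h0 hzw)
  · exact SingularValueCalculus.lipschitz_constants_of_bounds _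
      (fun f K hK hf h0 => SingularValueCalculus.opLipConst_le hK hf h0)
      (fun f h0 z w hzw => SingularValueCalculus.le_opLipConst h0 hzw)
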